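/- An extended metric space is a nonempty set with a metric taking values in $[0,+\infty]$. For extended metric spaces $X,Y$ write $X\precsim Y$ if for every finite sequence $x_1,\dots,x_N\in X$ there are points $y_{i,k}\in Y$ ($1\le i\le N$, $k=1,2,\dots$) such that $d_X(x_i,x_j)\le\liminf_{k\to\infty}d_Y(y_{i,k},y_{j,k})$ for all $i,j$, and write $X\sim Y$ if $X\precsim Y$ and $Y\precsim X$. Let $\mathcal M$ be the family of isometry classes of extended metric spaces; $\precsim$ is a preorder on $\mathcal M$ and $\sim$ is an equivalence relation. (To avoid set-theoretic problems, $\mathcal M$ consists of the classes of spaces in a fixed universe of sets.) Let $\mathcal H$ be the Gromov–Hausdorff space, i.e. the set of isometry classes of nonempty compact metric spaces with the Gromov–Hausdorff metric $d_{GH}$. For $N\ge 1$ let $\mathcal H(N,N)\subset\mathcal H$ be the set of classes of spaces with at most $N$ points and diameter at most $N$, and for an extended metric space $X$ let $\mathcal P_X:=\{Y\in\mathcal H\mid Y\precsim X\}$. Put $$\rho(X,Y):=\sum_{N=1}^\infty 2^{-N}\,d_H\bigl(\mathcal P_X\cap\mathcal H(N,N),\ \mathcal P_Y\cap\mathcal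 H(N,N)\bigr),$$ where $d_H$ is the Hausdorff distance with respect to $d_{GH}$. For an ultrafilter $\omega$ on $\mathbb N$ that is non-principal, the $\omega$-ultralimit of a sequence $X_n$ of extended metric spaces is the set of all sequences $(x_n)$ with $x_n\in X_n$, with the distance $d_\omega((x_n),(y_n))=\omega\text{-}\lim d_{X_n}(x_n,y_n)\in[0,+\infty]$, where sequences at distance $0$ are identified. Then the following hold. 1. $\rho$ induces a metric on $\mathcal M/{\sim}$, and $(\mathcal M/{\sim},\rho)$ is a compact metric space. 2. The natural projection $\mathcal H\to\mathcal M/{\sim}$, sending the isometry class of a compact metric space to its equivalence class, is $3$-Lipschitz and a topological embedding. 3. The image of this projection is dense in $(\mathcal M/{\sim},\rho)$. 4. If a sequence $X_n$ of extended metric spaces $\rho$-converges to an extended metric space $Y$, then for every non-principal ultrafilter $\omega$ on $\mathbb N$ the $\omega$-ultralimit of $X_n$ is equivalent to $Y$. -/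

import Mathlib

open Filter Topology
open scoped ENNReal

universe u v w

noncomputable section

namespace GHCompactification

/-! ### The finite-configuration preorder -/

/-- The relation `X ≾ Y` between (extended) metric spaces: every finite sequence of points
`x₁, …, x_N` of `X` admits sequences `y_{i,k}` of points of `Y` such that
`d_X(x_i, x_j) ≤ liminf_k d_Y(y_{i,k}, y_{j,k})` for all `i, j`. -/
def Precsim (X : Type u) (Y : Type v) [PseudoEMetricSpace X] [PseudoEMetricSpace Y] : Prop :=
  ∀ (N : ℕ) (x : Fin N → X), ∃ y : Fin N → ℕ → Y,
    ∀ i j, edist (x i) (x j) ≤ liminf (fun k => edist (y i k) (y j k)) atTop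

theorem precsim_of_isometry {X : Type u} {Y : Type v} [PseudoEMetricSpace X]
    [PseudoEMetricSpace Y] {f : X → Y} (hf : Isometry f) : Precsim X Y := by
  intro N x
  refine ⟨fun i _ => f (x i), fun i j => ?_⟩
  simp [hf.edist_eq]

theorem precsim_refl (X : Type u) [PseudoEMetricSpace X] : Precsim X X :=
  precsim_of_isometry isometry_id

theorem exists_seq_below (a : ℝ≥0∞) :
    ∃ s : ℕ → ℝ≥0∞, (∀ k, s k < a ∨ s k = 0) ∧ Tendsto s atTop (𝓝 a) := by
  rcases eq_or_ne a 0 with rfl | ha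
  · exact ⟨fun _ => 0, fun _ => Or.inr rfl, tendsto_const_nhds⟩
  · obtain ⟨s, -, h1, h2⟩ := exists_seq_strictMono_tendsto' (pos_iff_ne_zero.2 ha)
    exact ⟨s, fun k => Or.inl (h1 k).2, h2⟩

theorem precsim_iff (X : Type u) (Y : Type v) [PseudoEMetricSpace X] [PseudoEMetricSpace Y] :
    Precsim X Y ↔ ∀ (N : ℕ) (x : Fin N → X) (c : Fin N → Fin N → ℝ≥0∞),
      (∀ i j, c i j < edist (x i) (x j) ∨ c i j = 0) →
        ∃ y : Fin N → Y, ∀ i j, c i j ≤ edist (y i) (y j) := by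
  constructor
  · intro h N x c hc
    obtain ⟨y, hy⟩ := h N x
    have h1 : ∀ i j, ∀ᶠ k in atTop, c i j ≤ edist (y i k) (y j k) := by
      intro i j
      rcases hc i j with h2 | h2
      · exact (eventually_lt_of_lt_liminf (h2.trans_le (hy i j))).mono fun _ h => h.le
      · simp [h2]
    have h3 : ∀ᶠ k in atTop, ∀ i j, c i j ≤ edist (y i k) (y j k) := by
      simpa only [eventually_all] using h1
    obtain ⟨k, hk⟩ := h3.exists
    exact ⟨fun i => y i k, hk⟩
  · intro h N x
    choose s hs1 hs2 using fun i j => exists_seq_below (edist (x i) (x j))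
    choose y hy using fun k => h N x (fun i j => s i j k) (fun i j => hs1 i j k)
    refine ⟨fun i k => y k i, fun i j => ?_⟩
    rw [← (hs2 i j).liminf_eq]
    exact liminf_le_liminf (Eventually.of_forall fun k => hy k i j)

theorem precsim_trans {X : Type u} {Y : Type v} {Z : Type w} [PseudoEMetricSpace X]
    [PseudoEMetricSpace Y] [PseudoEMetricSpace Z] (h₁ : Precsim X Y) (h₂ : Precsim Y Z) :
    Precsim X Z := by
  rw [precsim_iff] at *
  intro N x c hc
  have h3 : ∀ i j, ∃ b, (b < edist (x i) (x j) ∨ b = 0) ∧ (c i j < b ∨ c i j = 0) := by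
    intro i j
    rcases hc i j with h | h
    · obtain ⟨b, hb1, hb2⟩ := exists_between h
      exact ⟨b, Or.inl hb2, Or.inl hb1⟩
    · exact ⟨0, Or.inr rfl, Or.inr h⟩
  choose b hb1 hb2 using h3
  obtain ⟨y, hy⟩ := h₁ N x b hb1
  exact h₂ N y c fun i j => (hb2 i j).imp_left fun h => h.trans_le (hy i j)

/-! ### Isometry classes of extended metric spaces, and the quotient by the equivalence -/

/-- A nonempty extended metric space. -/
structure ExtMetricSpace : Type (u + 1) where
  carrier : Type u
  [emetric : EMetricSpace carrier]
  [nonempty : Nonempty carrier]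

attribute [instance] ExtMetricSpace.emetric ExtMetricSpace.nonempty

/-- Two extended metric spaces are identified if they are isometric. -/
instance isometrySetoid : Setoid ExtMetricSpace.{u} where
  r X Y := Nonempty (X.carrier ≃ᵢ Y.carrier)
  iseqv :=
    { refl := fun X => ⟨IsometryEquiv.refl X.carrier⟩
      symm := fun ⟨e⟩ => ⟨e.symm⟩
      trans := fun ⟨e⟩ ⟨f⟩ => ⟨e.trans f⟩ }

/-- The family `𝓜` of isometry classes of (nonempty) extended metric spaces. -/
def IsomClass : Type (u + 1) := Quotient isometrySetoid.{u}

/-- The isometry class of an extended metric space. -/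
def IsomClass.mk (X : Type u) [EMetricSpace X] [Nonempty X] : IsomClass.{u} :=
  Quotient.mk isometrySetoid ⟨X⟩

/-- The relation `≾` on isometry classes. -/
def IsomClass.le (a b : IsomClass.{u}) : Prop :=
  Quotient.liftOn₂ a b (fun X Y => Precsim X.carrier Y.carrier) (by
    rintro X Y X' Y' ⟨e⟩ ⟨f⟩
    apply propext
    constructor
    · intro h
      exact precsim_trans (precsim_of_isometry e.symm.isometry)
        (precsim_trans h (precsim_of_isometry f.isometry))
    · intro h
      exact precsim_trans (precsim_of_isometry e.isometry)
        (precsim_trans h (precsim_of_isometry f.symm.isometry)))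

instance : Preorder IsomClass.{u} where
  le := IsomClass.le
  le_refl a := Quotient.inductionOn a fun X => precsim_refl X.carrier
  le_trans a b c := Quotient.inductionOn₃ a b c fun _ _ _ h₁ h₂ => precsim_trans h₁ h₂

/-- The quotient `𝓜/∼`, where `a ∼ b` means that `a ≾ b` and `b ≾ a`. -/
def MQuot : Type (u + 1) := Antisymmetrization IsomClass.{u} (· ≤ ·)

/-- The class in `𝓜/∼` of an extended metric space. -/
def MQuot.mk (X : Type u) [EMetricSpace X] [Nonempty X] : MQuot.{u} :=
  toAntisymmetrization (α := IsomClass.{u}) (· ≤ ·) (IsomClass.mk X)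

theorem MQuot.mk_eq_mk_iff (X Y : Type u) [EMetricSpace X] [Nonempty X] [EMetricSpace Y]
    [Nonempty Y] : MQuot.mk X = MQuot.mk Y ↔ Precsim X Y ∧ Precsim Y X :=
  Quotient.eq (r := AntisymmRel.setoid IsomClass.{u} (· ≤ ·))

/-! ### The distance `ρ`

`GromovHausdorff.GHSpace` is the space of isometry classes of nonempty compact metric spaces
with the Gromov–Hausdorff metric, and `p.Rep` is a compact metric space in the class `p`. -/

open GromovHausdorff

/-- `𝓟_X`: the classes of compact metric spaces `Y` with `Y ≾ X`. -/
def pyramidOf (X : Type u) [PseudoEMetricSpace X] : Set GHSpace :=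
  {p | Precsim p.Rep X}

/-- `𝓗(N, D)`: the classes of metric spaces with at most `N` points and diameter at most `D`. -/
def finiteSpaces (N : ℕ) (D : ℝ) : Set GHSpace :=
  {p | ENat.card p.Rep ≤ N ∧ Metric.diam (Set.univ : Set p.Rep) ≤ D}

/-- `ρ_N(X, Y)`: the Hausdorff distance, with respect to the Gromov–Hausdorff metric,
between `𝓟_X ∩ 𝓗(N, N)` and `𝓟_Y ∩ 𝓗(N, N)`. -/
def rhoN (N : ℕ) (X : Type u) (Y : Type v) [PseudoEMetricSpace X] [PseudoEMetricSpace Y] :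
    ℝ≥0∞ :=
  Metric.hausdorffEDist (pyramidOf X ∩ finiteSpaces N N) (pyramidOf Y ∩ finiteSpaces N N)

/-- `ρ(X, Y) = ∑_{N ≥ 1} 2^{-N} ρ_N(X, Y)`. -/
def rho (X : Type u) (Y : Type v) [PseudoEMetricSpace X] [PseudoEMetricSpace Y] : ℝ≥0∞ :=
  ∑' n : ℕ, (2⁻¹ : ℝ≥0∞) ^ (n + 1) * rhoN (n + 1) X Y

/-! ### The projection from the Gromov–Hausdorff space -/

/-- The natural map from the Gromov–Hausdorff space to `𝓜/∼`, sending the isometry class of a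
compact metric space to its equivalence class. -/
def proj (p : GHSpace) : MQuot.{u} := MQuot.mk (ULift.{u} p.Rep)

theorem proj_toGHSpace (X : Type u) [MetricSpace X] [CompactSpace X] [Nonempty X] :
    proj.{u} (toGHSpace X) = MQuot.mk X := by
  obtain ⟨e⟩ := toGHSpace_eq_toGHSpace_iff_isometryEquiv.1 (toGHSpace X).toGHSpace_rep
  refine (MQuot.mk_eq_mk_iff _ _).2 ⟨?_, ?_⟩
  · exact precsim_of_isometry (f := fun x : ULift.{u} (toGHSpace X).Rep => e x.down)
      fun x y => e.isometry x.down y.down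
  · exact precsim_of_isometry (f := fun x : X => (ULift.up.{u} (e.symm x)))
      fun x y => e.symm.isometry x y

/-! ### Ultralimits -/

/-- Sequences `(x_n)` with `x_n ∈ X_n`, to be equipped with the distance
`d_ω(x, y) = ω-lim d(x_n, y_n)`. -/
def UltraSeq (_ω : Ultrafilter ℕ) (X : ℕ → Type u) : Type u := ∀ n, X n

/-- The limit of the distances along `ω`, which exists since `[0, ∞]` is compact Hausdorff. -/
instance (ω : Ultrafilter ℕ) (X : ℕ → Type u) [∀ n, EMetricSpace (X n)] :
    EDist (UltraSeq ω X) :=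
  ⟨fun x y => (ω.map fun n => edist (x n) (y n)).lim⟩

theorem UltraSeq.tendsto_edist {ω : Ultrafilter ℕ} {X : ℕ → Type u} [∀ n, EMetricSpace (X n)]
    (x y : UltraSeq ω X) :
    Tendsto (fun n => edist (x n) (y n)) (ω : Filter ℕ) (𝓝 (edist x y)) :=
  (ω.map fun n => edist (x n) (y n)).le_nhds_lim

instance (ω : Ultrafilter ℕ) (X : ℕ → Type u) [∀ n, EMetricSpace (X n)] :
    PseudoEMetricSpace (UltraSeq ω X) where
  edist_self x := by
    refine tendsto_nhds_unique (UltraSeq.tendsto_edist x x) ?_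
    simp
  edist_comm x y := by
    refine tendsto_nhds_unique (UltraSeq.tendsto_edist x y) ?_
    simpa only [edist_comm] using UltraSeq.tendsto_edist y x
  edist_triangle x y z :=
    le_of_tendsto_of_tendsto' (UltraSeq.tendsto_edist x z)
      ((UltraSeq.tendsto_edist x y).add (UltraSeq.tendsto_edist y z))
      fun n => edist_triangle (x n) (y n) (z n)

instance (ω : Ultrafilter ℕ) (X : ℕ → Type u) [∀ n, Nonempty (X n)] :
    Nonempty (UltraSeq ω X) :=
  inferInstanceAs (Nonempty (∀ n, X n))

/-- The `ω`-ultralimit of a sequence of extended metric spaces: all sequences, with two of them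
identified when their `ω`-distance is zero. -/
abbrev UltraLimit (ω : Ultrafilter ℕ) (X : ℕ → Type u) [∀ n, EMetricSpace (X n)] : Type u :=
  SeparationQuotient (UltraSeq ω X)

end GHCompactification

end

open GromovHausdorff
open scoped NNReal

namespace GHCompactification

/-! ### Approximate domination of finite configurations -/

/-! Everything reduces to maps of finite configurations that lose only a small additive error. `X ≾
Y` means that each finite configuration of `X`, truncated at any finite level, maps to `Y` with
arbitrarily small loss (`precsim_iff_approx`). Such a map out of a finite space can be corrected: a
small perturbation of the space is genuinely dominated by the target
(`exists_mem_pyramidOf_dist_le`). As `𝓗(N, N)` is totally bounded, each `ρ_N` is controlled, up to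
any error, by finitely many points (`exists_finite_detecting`), and `ρ_N ≤ N` makes the tail of `ρ`
uniformly small.

The core is `tendsto_rho_ultraSeq`: along any ultrafilter `ω`, every sequence converges for `ρ` to
its `ω`-ultralimit. This gives sequential compactness, and with uniqueness of limits the statement
on ultralimits. Density holds because a finite truncated configuration containing the detecting
points is `ρ`-close to the whole space.

For compact spaces, mutual domination gives expanding maps both ways, and an expanding self-map of a
compact space is a surjective isometry; hence the projection is injective. It is inducing because
compact spaces `ρ`-close to a fixed compact one have uniformly bounded diameters and nets
(`exists_finite_cover_of_rho_lt`): an ultrafilter whose image converges to the class of `p` is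
Cauchy, so it converges in the complete Gromov–Hausdorff space, and injectivity forces its limit to
be `p`. -/

theorem precsim_iff_approx {X : Type u} {Y : Type v} [PseudoEMetricSpace X]
    [PseudoEMetricSpace Y] : Precsim X Y ↔ ∀ (n : ℕ) (x : Fin n → X) (M δ : ℝ≥0), 0 < δ →
      ∃ y : Fin n → Y, ∀ i j, min (edist (x i) (x j)) M ≤ edist (y i) (y j) + δ := by
  rw [precsim_iff]
  constructor
  · intro h n x M δ hδ
    obtain ⟨y, hy⟩ := h n x (fun i j => min (edist (x i) (x j)) M - δ) fun i j => by
      rcases eq_or_ne (min (edist (x i) (x j)) (M : ℝ≥0∞)) 0 with h0 | h0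
      · exact Or.inr (by simp [h0])
      · refine Or.inl ((ENNReal.sub_lt_self ?_ h0 (by simpa using hδ.ne')).trans_le
          (min_le_left _ _))
        exact ne_top_of_le_ne_top ENNReal.coe_ne_top (min_le_right _ _)
    exact ⟨y, fun i j => tsub_le_iff_right.1 (hy i j)⟩
  · intro h n x c hc
    have hfin : ∀ i j, c i j ≠ ⊤ := fun i j =>
      (hc i j).elim (fun h => h.ne_top) fun h => by simp [h]
    have h1 : ∀ i j, ∀ᶠ δ : ℝ≥0 in 𝓝[>] 0, c i j + δ ≤ edist (x i) (x j) ∨ c i j = 0 := by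
      intro i j
      rcases hc i j with h | h
      · have h2 : Tendsto (fun δ : ℝ≥0 => c i j + (δ : ℝ≥0∞)) (𝓝[>] 0) (𝓝 (c i j)) := by
          have : Continuous fun δ : ℝ≥0 => c i j + (δ : ℝ≥0∞) := by fun_prop
          simpa using (this.tendsto 0).mono_left nhdsWithin_le_nhds
        exact (h2.eventually_lt_const h).mono fun δ hδ => Or.inl hδ.le
      · simp [h]
    have h2 : ∀ᶠ δ : ℝ≥0 in 𝓝[>] 0, ∀ i j, c i j + δ ≤ edist (x i) (x j) ∨ c i j = 0 := by
      simpa only [eventually_all] using h1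
    obtain ⟨δ, hδ, hδ0⟩ := (h2.and self_mem_nhdsWithin).exists
    obtain ⟨y, hy⟩ := h n x ((∑ i, ∑ j, c i j).toNNReal + δ) δ hδ0
    refine ⟨y, fun i j => ?_⟩
    rcases hδ i j with h3 | h3
    · refine (ENNReal.add_le_add_iff_right (a := (δ : ℝ≥0∞)) ENNReal.coe_ne_top).1
        ((le_min h3 ?_).trans (hy i j))
      rw [ENNReal.coe_add, ENNReal.coe_toNNReal (by simp [ENNReal.sum_eq_top, hfin])]
      gcongr
      exact (Finset.single_le_sum (f := fun j => c i j) (fun _ _ => zero_le)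
        (Finset.mem_univ j)).trans (Finset.single_le_sum (f := fun i => ∑ j, c i j)
        (fun _ _ => zero_le) (Finset.mem_univ i))
    · simp [h3]

theorem Precsim.exists_approx {X : Type u} {Y : Type v} [PseudoEMetricSpace X]
    [PseudoEMetricSpace Y] (h : Precsim X Y) {ι : Type*} [Finite ι] (x : ι → X) (M : ℝ≥0)
    {δ : ℝ≥0} (hδ : 0 < δ) :
    ∃ y : ι → Y, ∀ i j, min (edist (x i) (x j)) M ≤ edist (y i) (y j) + δ := by
  obtain ⟨n, ⟨e⟩⟩ := Finite.exists_equiv_fin ι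
  obtain ⟨y, hy⟩ := precsim_iff_approx.1 h n (x ∘ e.symm) M δ hδ
  exact ⟨y ∘ e, fun i j => by simpa using hy (e i) (e j)⟩

/-- In an optimal common embedding, send each point to a point of the other space within `δ`; both
endpoints contribute `δ` to the loss. The map need not be continuous. -/
theorem exists_expansion_of_dist_lt {p q : GHSpace} {δ : ℝ≥0} (h : dist p q < δ) :
    ∃ φ : p.Rep → q.Rep, ∀ a b, edist a b ≤ edist (φ a) (φ b) + (2 * δ : ℝ≥0) := by
  rw [dist_ghDist] at h
  obtain ⟨Φ, Ψ, hΦ, hΨ, he⟩ := ghDist_eq_hausdorffDist p.Rep q.Rep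
  rw [he] at h
  have hfin : Metric.hausdorffEDist (Set.range Φ) (Set.range Ψ) ≠ ⊤ :=
    Metric.hausdorffEDist_ne_top_of_nonempty_of_bounded (Set.range_nonempty _)
      (Set.range_nonempty _) (isCompact_range hΦ.continuous).isBounded
      (isCompact_range hΨ.continuous).isBounded
  have h1 : ∀ a : p.Rep, ∃ b : q.Rep, dist (Φ a) (Ψ b) < δ := by
    intro a
    obtain ⟨_, ⟨b, rfl⟩, hb⟩ := Metric.exists_dist_lt_of_hausdorffDist_lt (Set.mem_range_self a)
      h hfin
    exact ⟨b, hb⟩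
  choose φ hφ using h1
  refine ⟨φ, fun a b => ?_⟩
  have h2 : dist a b ≤ dist (φ a) (φ b) + 2 * δ := by
    rw [← hΦ.dist_eq, ← hΨ.dist_eq]
    have := dist_triangle4 (Φ a) (Ψ (φ a)) (Ψ (φ b)) (Φ b)
    have h3 := hφ a
    have h4 := hφ b
    rw [dist_comm] at h4
    linarith
  have h5 : nndist a b ≤ nndist (φ a) (φ b) + 2 * δ := by exact_mod_cast h2
  rw [edist_nndist, edist_nndist]
  exact_mod_cast h5

/-! ### Finite models -/

/-- The class in the Gromov–Hausdorff space of the range of a finite family of points. -/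
def rangeSpace {ι : Type*} {E : Type*} [Finite ι] [Nonempty ι] [MetricSpace E] (f : ι → E) :
    GHSpace :=
  toGHSpace (Set.range f)

section rangeSpace

variable {ι : Type*} {E : Type*} [Finite ι] [Nonempty ι] [MetricSpace E] {f : ι → E}

theorem exists_surjective_rangeSpace (f : ι → E) : ∃ g : ι → (rangeSpace f).Rep,
    Function.Surjective g ∧ ∀ a b, edist (g a) (g b) = edist (f a) (f b) := by
  obtain ⟨e⟩ := toGHSpace_eq_toGHSpace_iff_isometryEquiv.1 (rangeSpace f).toGHSpace_rep
  refine ⟨fun a => e.symm ⟨f a, a, rfl⟩, ?_, fun a b => ?_⟩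
  · exact e.symm.surjective.comp Set.rangeFactorization_surjective
  · rw [e.symm.isometry.edist_eq]
    rfl

theorem rangeSpace_mem_finiteSpaces {N : ℕ} {D : ℝ} (hD : 0 ≤ D) (hN : Nat.card ι ≤ N)
    (hf : ∀ a b, dist (f a) (f b) ≤ D) : rangeSpace f ∈ finiteSpaces N D := by
  obtain ⟨g, hg, he⟩ := exists_surjective_rangeSpace f
  have : Finite (rangeSpace f).Rep := Finite.of_surjective g hg
  refine ⟨?_, Metric.diam_le_of_forall_dist_le hD ?_⟩
  · rw [ENat.card_eq_coe_natCard]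
    exact_mod_cast (Nat.card_le_card_of_surjective g hg).trans hN
  · intro a _ b _
    obtain ⟨a, rfl⟩ := hg a
    obtain ⟨b, rfl⟩ := hg b
    rw [dist_edist, he, ← dist_edist]
    exact hf a b

theorem rangeSpace_mem_pyramidOf {Y : Type v} [PseudoEMetricSpace Y] (y : ι → Y)
    (h : ∀ a b, edist (f a) (f b) ≤ edist (y a) (y b)) : rangeSpace f ∈ pyramidOf Y := by
  obtain ⟨g, hg, he⟩ := exists_surjective_rangeSpace f
  intro n x
  choose s hs using hg
  refine ⟨fun i _ => y (s (x i)), fun i j => ?_⟩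
  rw [liminf_const]
  refine le_trans ?_ (h _ _)
  rw [← he, hs, hs]

end rangeSpace

theorem dist_rangeSpace_le {p : GHSpace} {ι : Type*} [Finite ι] [Nonempty ι] {E : Type*}
    [MetricSpace E] {Ψ : p.Rep → E} {f : ι → E} (hΨ : Isometry Ψ) {δ : ℝ} (hδ : 0 ≤ δ)
    (h : ∀ a, ∃ i, dist (Ψ a) (f i) ≤ δ) (h' : ∀ i, ∃ a, dist (Ψ a) (f i) ≤ δ) :
    dist p (rangeSpace f) ≤ δ := by
  have h1 : dist p (rangeSpace f) = ghDist p.Rep (Set.range f) := by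
    rw [ghDist, p.toGHSpace_rep, rangeSpace]
  rw [h1]
  refine (ghDist_le_hausdorffDist hΨ isometry_subtype_coe).trans ?_
  rw [Subtype.range_coe]
  refine Metric.hausdorffDist_le_of_mem_dist hδ ?_ ?_
  · rintro _ ⟨a, rfl⟩
    obtain ⟨i, hi⟩ := h a
    exact ⟨f i, ⟨i, rfl⟩, hi⟩
  · rintro _ ⟨i, rfl⟩
    obtain ⟨a, ha⟩ := h' i
    exact ⟨Ψ a, ⟨a, rfl⟩, by rwa [dist_comm]⟩

theorem finite_rep_of_mem {N : ℕ} {D : ℝ} {p : GHSpace} (hp : p ∈ finiteSpaces N D) :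
    Finite p.Rep := by
  have := hp.1
  by_contra h
  rw [not_finite_iff_infinite] at h
  simp [ENat.card_eq_top_of_infinite] at this

theorem natCard_rep_le_of_mem {N : ℕ} {D : ℝ} {p : GHSpace} (hp : p ∈ finiteSpaces N D) :
    Nat.card p.Rep ≤ N := by
  have := finite_rep_of_mem hp
  have h := hp.1
  rw [ENat.card_eq_coe_natCard] at h
  exact_mod_cast h

theorem dist_rep_le_of_mem {N : ℕ} {D : ℝ} {p : GHSpace} (hp : p ∈ finiteSpaces N D)
    (a b : p.Rep) : dist a b ≤ D :=
  (Metric.dist_le_diam_of_mem isCompact_univ.isBounded (Set.mem_univ a) (Set.mem_univ b)).trans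
    hp.2

/-- A finite metric space that is dominated by `Y` up to an additive error `δ` lies within `δ`
of one that is dominated by `Y`. -/
theorem exists_mem_pyramidOf_dist_le {N : ℕ} {p : GHSpace} (hp : p ∈ finiteSpaces N N)
    {Y : Type v} [PseudoEMetricSpace Y] (y : p.Rep → Y) {δ : ℝ≥0}
    (h : ∀ a b, edist a b ≤ edist (y a) (y b) + δ) :
    ∃ q ∈ pyramidOf Y ∩ finiteSpaces N N, edist p q ≤ δ := by
  have := finite_rep_of_mem hp
  have := Fintype.ofFinite p.Rep
  -- Infimal convolution of the Kuratowski functions `κ` of `p` with the pulled-back distance of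
  -- `Y`. It makes `a ↦ F a` 1-Lipschitz for the distance of `Y` (`hF4`), while `hF1` and `hF3` keep
  -- `F a` within `δ` of `κ a`. The required space is the set of these functions under the sup norm.
  let F : p.Rep → p.Rep → ℝ≥0∞ := fun a i => ⨅ k, edist i k + edist (y a) (y k)
  have hF1 : ∀ a i, F a i ≤ edist i a := fun a i => (iInf_le _ a).trans (by simp)
  have hF2 : ∀ a i, F a i ≠ ⊤ := fun a i => ne_top_of_le_ne_top (edist_ne_top i a) (hF1 a i)
  have hF3 : ∀ a i, edist i a ≤ F a i + δ := by
    intro a i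
    rw [ENNReal.iInf_add]
    refine le_iInf fun k => ?_
    rw [add_assoc]
    refine (edist_triangle i k a).trans ?_
    gcongr
    rw [edist_comm]
    exact h a k
  have hF4 : ∀ a b i, F a i ≤ F b i + edist (y a) (y b) := by
    intro a b i
    rw [ENNReal.iInf_add]
    refine le_iInf fun k => (iInf_le _ k).trans ?_
    rw [add_assoc, add_comm (edist (y b) (y k))]
    gcongr
    exact edist_triangle _ _ _
  let f : p.Rep → p.Rep → ℝ := fun a i => (F a i).toReal
  let κ : p.Rep → p.Rep → ℝ := fun a i => dist i a
  have hκ : Isometry κ := by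
    refine Isometry.of_dist_eq fun a b => le_antisymm ?_ ?_
    · refine (dist_pi_le_iff dist_nonneg).2 fun i => ?_
      change |dist i a - dist i b| ≤ dist a b
      rw [dist_comm i a, dist_comm i b]
      exact abs_dist_sub_le a b i
    · refine le_trans ?_ (dist_le_pi_dist (κ a) (κ b) b)
      simp [κ, Real.dist_eq, dist_comm]
  have hf1 : ∀ a i, f a i ≤ dist i a := fun a i => by
    rw [dist_edist]
    exact ENNReal.toReal_mono (edist_ne_top _ _) (hF1 a i)
  have hf2 : ∀ a i, dist i a ≤ f a i + δ := fun a i => by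
    rw [dist_edist, ← ENNReal.coe_toReal, ← ENNReal.toReal_add (hF2 a i) ENNReal.coe_ne_top]
    exact ENNReal.toReal_mono (by simp [hF2]) (hF3 a i)
  have hf0 : ∀ a i, 0 ≤ f a i := fun a i => ENNReal.toReal_nonneg
  refine ⟨rangeSpace f, ⟨rangeSpace_mem_pyramidOf y fun a b => ?_,
    rangeSpace_mem_finiteSpaces (Nat.cast_nonneg N) (natCard_rep_le_of_mem hp) fun a b => ?_⟩, ?_⟩
  · refine (edist_pi_le_iff).2 fun i => ?_
    by_cases ht : edist (y a) (y b) = ⊤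
    · simp [ht]
    · rw [edist_dist, Real.dist_eq]
      refine ENNReal.ofReal_le_of_le_toReal (abs_sub_le_iff.2 ⟨?_, ?_⟩)
      · rw [sub_le_iff_le_add', ← ENNReal.toReal_add (hF2 b i) ht]
        exact ENNReal.toReal_mono (by simp [hF2, ht]) (hF4 a b i)
      · rw [sub_le_iff_le_add', ← ENNReal.toReal_add (hF2 a i) ht]
        refine ENNReal.toReal_mono (by simp [hF2, ht]) ?_
        rw [edist_comm]
        exact hF4 b a i
  · refine (dist_pi_le_iff (Nat.cast_nonneg N)).2 fun i => ?_
    have h1 := (hf1 a i).trans (dist_rep_le_of_mem hp i a)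
    have h2 := (hf1 b i).trans (dist_rep_le_of_mem hp i b)
    have h3 := hf0 a i
    have h4 := hf0 b i
    exact abs_sub_le_iff.2 ⟨by linarith, by linarith⟩
  · rw [edist_dist, ← ENNReal.ofReal_coe_nnreal]
    have hκf : ∀ a, dist (κ a) (f a) ≤ δ := by
      refine fun a => (dist_pi_le_iff (NNReal.coe_nonneg δ)).2 fun i => ?_
      have h1 := hf1 a i
      have h2 := hf2 a i
      have h3 := NNReal.coe_nonneg δ
      exact abs_sub_le_iff.2 ⟨by simp only [κ]; linarith, by simp only [κ]; linarith⟩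
    exact ENNReal.ofReal_le_ofReal (dist_rangeSpace_le hκ (NNReal.coe_nonneg δ)
      (fun a => ⟨a, hκf a⟩) fun a => ⟨a, hκf a⟩)

/-- A truncated finite configuration of `X` is a finite metric space dominated by `X`. -/
theorem exists_rangeSpace_truncation {X : Type u} [PseudoEMetricSpace X] {n N : ℕ} [NeZero n]
    (x : Fin n → X) (M : ℝ≥0) (hn : n ≤ N) (hM : M ≤ N) :
    ∃ p ∈ pyramidOf X ∩ finiteSpaces N N, ∃ g : Fin n → p.Rep, Function.Surjective g ∧
      ∀ i j, edist (g i) (g j) = min (edist (x i) (x j)) M := by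
  let D : Fin n → Fin n → ℝ≥0∞ := fun i j => min (edist (x i) (x j)) M
  have hD : ∀ i j, D i j ≠ ⊤ := fun i j =>
    ne_top_of_le_ne_top ENNReal.coe_ne_top (min_le_right _ _)
  have htri : ∀ i j k, D i k ≤ D i j + D j k := by
    intro i j k
    rcases le_total (edist (x i) (x j)) M with h1 | h1
    · rcases le_total (edist (x j) (x k)) M with h2 | h2
      · simp only [D, min_eq_left h1, min_eq_left h2]
        exact (min_le_left _ _).trans (edist_triangle _ _ _)
      · simp only [D, min_eq_right h2]
        exact (min_le_right _ _).trans le_add_self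
    · simp only [D, min_eq_right h1]
      exact (min_le_right _ _).trans le_self_add
  have hcomm : ∀ i j, D i j = D j i := fun i j => by simp only [D, edist_comm]
  let f : Fin n → Fin n → ℝ := fun i k => (D i k).toReal
  have hf : ∀ i j, edist (f i) (f j) = D i j := by
    intro i j
    have key : ∀ i j k, f i k - f j k ≤ (D i j).toReal := fun i j k => by
      rw [sub_le_iff_le_add, ← ENNReal.toReal_add (hD _ _) (hD _ _)]
      exact ENNReal.toReal_mono (by simp [hD]) (htri i j k)
    refine le_antisymm (edist_pi_le_iff.2 fun k => ?_) ?_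
    · rw [edist_dist, Real.dist_eq]
      refine ENNReal.ofReal_le_of_le_toReal (abs_sub_le_iff.2 ⟨key i j k, ?_⟩)
      rw [hcomm]
      exact key j i k
    · refine le_trans ?_ (edist_le_pi_edist (f i) (f j) j)
      have : f j j = 0 := by simp [f, D]
      rw [this, edist_dist, Real.dist_eq, sub_zero, abs_of_nonneg ENNReal.toReal_nonneg,
        ENNReal.ofReal_toReal (hD i j)]
  obtain ⟨g, hg, he⟩ := exists_surjective_rangeSpace f
  refine ⟨rangeSpace f, ⟨rangeSpace_mem_pyramidOf x fun i j => ?_,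
    rangeSpace_mem_finiteSpaces (Nat.cast_nonneg N) (by simpa using hn) fun i j => ?_⟩, g, hg,
    fun i j => by rw [he, hf]⟩
  · rw [hf]
    exact min_le_left _ _
  · rw [dist_edist, hf]
    refine ENNReal.toReal_le_of_le_ofReal (Nat.cast_nonneg N) ?_
    refine (min_le_right _ _).trans ?_
    rw [ENNReal.ofReal_natCast]
    exact_mod_cast hM

/-! ### Comparing the finite spaces dominated by two spaces -/

theorem edist_rep_le_of_mem {N : ℕ} {p : GHSpace} (hp : p ∈ finiteSpaces N N) (a b : p.Rep) :
    edist a b ≤ N := by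
  rw [edist_dist, ← ENNReal.ofReal_natCast]
  exact ENNReal.ofReal_le_ofReal (dist_rep_le_of_mem hp a b)

theorem exists_approx_rep {N : ℕ} {Y : Type v} [PseudoEMetricSpace Y] {p : GHSpace}
    (hp : p ∈ pyramidOf Y ∩ finiteSpaces N N) {δ : ℝ≥0} (hδ : 0 < δ) :
    ∃ y : p.Rep → Y, ∀ a b, edist a b ≤ edist (y a) (y b) + δ := by
  have := finite_rep_of_mem hp.2
  obtain ⟨y, hy⟩ := Precsim.exists_approx hp.1 id N hδ
  refine ⟨y, fun a b => ?_⟩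
  rw [← min_eq_left (edist_rep_le_of_mem hp.2 a b)]
  simpa using hy a b

/-- The truncated configuration is a point of `𝓟_X ∩ 𝓗(N, N)`, hence `δ`-close to one of `𝓟_Y ∩ 𝓗(N,
N)`. Moving there costs `2δ`, and mapping on to `Y` costs another `δ`. -/
theorem exists_approx_of_rhoN_lt {X : Type u} {Y : Type v} [PseudoEMetricSpace X]
    [PseudoEMetricSpace Y] {n N : ℕ} {M δ : ℝ≥0} (hn : n ≤ N) (hM : M ≤ N)
    (h : rhoN N X Y < δ) (x : Fin n → X) :
    ∃ y : Fin n → Y, ∀ i j,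
      min (edist (x i) (x j)) M ≤ edist (y i) (y j) + (3 * δ : ℝ≥0) := by
  have hδ : 0 < δ := by exact_mod_cast (zero_le (a := rhoN N X Y)).trans_lt h
  rcases Nat.eq_zero_or_pos n with rfl | hn0
  · exact ⟨fun i => i.elim0, fun i => i.elim0⟩
  have : NeZero n := ⟨hn0.ne'⟩
  obtain ⟨p, hp, g, -, hg⟩ := exists_rangeSpace_truncation x M hn hM
  obtain ⟨q, hq, hpq⟩ := Metric.exists_edist_lt_of_hausdorffEDist_lt hp h
  rw [edist_nndist, ENNReal.coe_lt_coe, ← NNReal.coe_lt_coe, coe_nndist] at hpq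
  obtain ⟨φ, hφ⟩ := exists_expansion_of_dist_lt hpq
  obtain ⟨y, hy⟩ := exists_approx_rep hq hδ
  refine ⟨fun i => y (φ (g i)), fun i j => ?_⟩
  rw [← hg]
  refine (hφ _ _).trans ((add_le_add_left (hy _ _) _).trans_eq ?_)
  rw [add_assoc, ← ENNReal.coe_add]
  congr 2
  ring

theorem totallyBounded_finiteSpaces (N : ℕ) : TotallyBounded (finiteSpaces N N) := by
  refine GromovHausdorff.totallyBounded (u := fun n : ℕ => 1 / ((n : ℝ) + 1)) (K := fun _ => N)
    (C := N) tendsto_one_div_add_atTop_nhds_zero_nat (fun p hp => hp.2) fun p hp n => ?_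
  have := finite_rep_of_mem hp
  refine ⟨Set.univ, ?_, fun x _ => ?_⟩
  · rw [Cardinal.mk_univ, ← Nat.cast_card]
    exact_mod_cast natCard_rep_le_of_mem hp
  · exact Set.mem_biUnion (Set.mem_univ x) (Metric.mem_ball_self Nat.one_div_pos_of_nat)

theorem exists_finite_net {N : ℕ} {s : Set GHSpace} (hs : s ⊆ finiteSpaces N N) {ε : ℝ≥0}
    (hε : 0 < ε) : ∃ t ⊆ s, t.Finite ∧ ∀ p ∈ s, ∃ q ∈ t, edist p q < ε := by
  obtain ⟨t, hts, ht, hcov⟩ := totallyBounded_iff_subset.1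
    ((totallyBounded_finiteSpaces N).subset hs) _
    (edist_mem_uniformity (ENNReal.coe_pos.2 hε))
  refine ⟨t, hts, ht, fun p hp => ?_⟩
  obtain ⟨q, hq, h⟩ := Set.mem_iUnion₂.1 (hcov hp)
  exact ⟨q, hq, h⟩

/-- Up to a given error, the finite spaces in `𝓗(N, N)` dominated by `X` are detected by
finitely many points of `X`. -/
theorem exists_finite_detecting (X : Type u) [PseudoEMetricSpace X] (N : ℕ) {ε : ℝ≥0}
    (hε : 0 < ε) : ∃ S : Set X, S.Finite ∧ ∀ (Y : Type v) [PseudoEMetricSpace Y] (φ : X → Y),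
      (∀ s ∈ S, ∀ t ∈ S, min (edist s t) N ≤ edist (φ s) (φ t) + ε) →
        ∀ p ∈ pyramidOf X ∩ finiteSpaces N N, ∃ q ∈ pyramidOf Y ∩ finiteSpaces N N,
          edist p q ≤ (3 * ε : ℝ≥0) := by
  obtain ⟨t, hts, htf, ht⟩ := exists_finite_net
    (Set.inter_subset_right : pyramidOf X ∩ finiteSpaces N N ⊆ _) hε
  choose x hx using fun (p : GHSpace) (hp : p ∈ t) => exists_approx_rep (hts hp) hε
  refine ⟨⋃ (p) (hp : p ∈ t), Set.range (x p hp), ?_, fun Y _ φ hφ p hp => ?_⟩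
  · refine htf.biUnion' fun p hp => ?_
    have := finite_rep_of_mem (hts hp).2
    exact Set.finite_range _
  · obtain ⟨p', hp', hpp'⟩ := ht p hp
    -- One `ε` is lost in placing the net point `p'` in `X`, one under `φ`; the distance from `p` to
    -- `p'` adds the third.
    obtain ⟨q, hq, hqp⟩ := exists_mem_pyramidOf_dist_le (hts hp').2 (Y := Y) (δ := 2 * ε)
        (fun a => φ (x p' hp' a)) fun a b => by
      have h1 := hφ _ (Set.mem_iUnion₂.2 ⟨p', hp', a, rfl⟩) _ (Set.mem_iUnion₂.2 ⟨p', hp', b, rfl⟩)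
      calc edist a b ≤ min (edist (x p' hp' a) (x p' hp' b) + ε) (N + ε) :=
            le_min (hx p' hp' a b) ((edist_rep_le_of_mem (hts hp').2 a b).trans le_self_add)
        _ = min (edist (x p' hp' a) (x p' hp' b)) N + ε := (min_add_add_right _ _ _)
        _ ≤ edist (φ (x p' hp' a)) (φ (x p' hp' b)) + ε + ε := by gcongr
        _ = _ := by
          rw [add_assoc, ← ENNReal.coe_add]
          congr 2
          ring
    refine ⟨q, hq, (edist_triangle p p' q).trans ((add_le_add hpp'.le hqp).trans_eq ?_)⟩
    rw [← ENNReal.coe_add]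
    congr 1
    ring

/-! ### The distance `ρ` -/

theorem rhoN_le (X : Type u) (Y : Type v) [PseudoEMetricSpace X] [PseudoEMetricSpace Y]
    [hX : Nonempty X] [hY : Nonempty Y] (N : ℕ) : rhoN N X Y ≤ N := by
  refine Metric.hausdorffEDist_le_of_mem_edist (fun p hp => ?_) fun p hp => ?_
  · obtain ⟨y⟩ := hY
    -- A constant map loses at most the diameter, which is at most `N`.
    obtain ⟨q, hq, h⟩ := exists_mem_pyramidOf_dist_le hp.2 (fun _ => y) (δ := N) fun a b => by
      simpa using edist_rep_le_of_mem hp.2 a b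
    exact ⟨q, hq, by simpa using h⟩
  · obtain ⟨x⟩ := hX
    obtain ⟨q, hq, h⟩ := exists_mem_pyramidOf_dist_le hp.2 (fun _ => x) (δ := N) fun a b => by
      simpa using edist_rep_le_of_mem hp.2 a b
    exact ⟨q, hq, by simpa using h⟩

theorem tsum_geometric_half : ∑' n : ℕ, (2⁻¹ : ℝ≥0∞) ^ (n + 1) = 1 := by
  simp_rw [pow_succ']
  rw [ENNReal.tsum_mul_left, ENNReal.tsum_geometric, ENNReal.one_sub_inv_two, inv_inv]
  exact ENNReal.inv_mul_cancel (by simp) (by simp)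

theorem tsum_mul_geometric_half_ne_top :
    ∑' n : ℕ, (2⁻¹ : ℝ≥0∞) ^ (n + 1) * ((n + 1 : ℕ) : ℝ≥0∞) ≠ ⊤ := by
  have h : Summable fun n : ℕ => (n : ℝ≥0) * (2⁻¹ : ℝ≥0) ^ n := by
    rw [← NNReal.summable_coe]
    simpa using summable_pow_mul_geometric_of_norm_lt_one 1 (r := (2⁻¹ : ℝ)) (by norm_num)
  have h1 : Summable fun n : ℕ => ((n + 1 : ℕ) : ℝ≥0) * (2⁻¹ : ℝ≥0) ^ (n + 1) :=
    (NNReal.summable_nat_add_iff 1).2 h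
  have h2 : ∀ n : ℕ, (2⁻¹ : ℝ≥0∞) ^ (n + 1) * ((n + 1 : ℕ) : ℝ≥0∞) =
      ((((n + 1 : ℕ) : ℝ≥0) * 2⁻¹ ^ (n + 1) : ℝ≥0) : ℝ≥0∞) := fun n => by
    rw [mul_comm]
    push_cast
    rfl
  simp_rw [h2]
  exact ENNReal.tsum_coe_ne_top_iff_summable.2 h1

theorem rho_ne_top (X : Type u) (Y : Type v) [PseudoEMetricSpace X] [PseudoEMetricSpace Y]
    [Nonempty X] [Nonempty Y] : rho X Y ≠ ⊤ :=
  ne_top_of_le_ne_top tsum_mul_geometric_half_ne_top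
    (ENNReal.tsum_le_tsum fun n => by gcongr; exact rhoN_le X Y _)

theorem rho_le_of_rhoN_le {X : Type u} {Y : Type v} [PseudoEMetricSpace X]
    [PseudoEMetricSpace Y] {ε : ℝ≥0∞} (h : ∀ N, rhoN N X Y ≤ ε) : rho X Y ≤ ε :=
  calc rho X Y ≤ ∑' n : ℕ, (2⁻¹ : ℝ≥0∞) ^ (n + 1) * ε :=
        ENNReal.tsum_le_tsum fun n => by gcongr; exact h _
    _ = ε := by rw [ENNReal.tsum_mul_right, tsum_geometric_half, one_mul]

/-- The head has total weight at most `1`, and the tail is bounded by that of the convergent series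
`∑ w n * b n`; hence `N₀` is independent of `r`. -/
theorem exists_tsum_mul_le {w b : ℕ → ℝ≥0∞} (hw : ∑' n, w n = 1) (hb : ∑' n, w n * b n ≠ ⊤)
    {ε : ℝ≥0} (hε : 0 < ε) : ∃ N₀ : ℕ, ∀ r : ℕ → ℝ≥0∞, (∀ n, r n ≤ b n) →
      (∀ n < N₀, r n ≤ ε) → ∑' n, w n * r n ≤ (2 * ε : ℝ≥0) := by
  obtain ⟨N₀, hN₀⟩ := ((ENNReal.tendsto_sum_nat_add _ hb).eventually_le_const
    (ENNReal.coe_pos.2 hε)).exists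
  refine ⟨N₀, fun r hr h => ?_⟩
  have hhead : ∑ n ∈ Finset.range N₀, w n * r n ≤ ε :=
    calc ∑ n ∈ Finset.range N₀, w n * r n
        ≤ ∑ n ∈ Finset.range N₀, w n * ε :=
          Finset.sum_le_sum fun n hn => mul_le_mul_right (h _ (Finset.mem_range.1 hn)) _
      _ = (∑ n ∈ Finset.range N₀, w n) * ε := by rw [Finset.sum_mul]
      _ ≤ 1 * ε := mul_le_mul_left ((ENNReal.sum_le_tsum _).trans_eq hw) _
      _ = ε := one_mul _
  have htail : ∑' n : ℕ, w (n + N₀) * r (n + N₀) ≤ ε :=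
    (ENNReal.tsum_le_tsum fun _ => mul_le_mul_right (hr _) _).trans hN₀
  rw [← Summable.sum_add_tsum_nat_add' (f := fun n => w n * r n) (k := N₀) ENNReal.summable,
    two_mul,
    ENNReal.coe_add]
  exact add_le_add hhead htail

theorem exists_rho_le_of_rhoN_le {ε : ℝ≥0} (hε : 0 < ε) : ∃ N₀ : ℕ, ∀ (X : Type u) (Y : Type v)
    [PseudoEMetricSpace X] [PseudoEMetricSpace Y] [Nonempty X] [Nonempty Y],
      (∀ N ≤ N₀, rhoN N X Y ≤ ε) → rho X Y ≤ (2 * ε : ℝ≥0) := by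
  obtain ⟨N₀, hN₀⟩ := exists_tsum_mul_le tsum_geometric_half tsum_mul_geometric_half_ne_top hε
  exact ⟨N₀, fun X Y _ _ _ _ h =>
    hN₀ _ (fun n => rhoN_le X Y _) fun n hn => h _ (Nat.succ_le_of_lt hn)⟩

theorem exists_rhoN_lt_of_rho_lt (N : ℕ) {δ : ℝ≥0} (hδ : 0 < δ) : ∃ η : ℝ≥0, 0 < η ∧
    ∀ (X : Type u) (Y : Type v) [PseudoEMetricSpace X] [PseudoEMetricSpace Y],
      rho X Y < η → rhoN (N + 1) X Y < δ := by
  refine ⟨2⁻¹ ^ (N + 1) * δ, by positivity, fun X Y _ _ h => ?_⟩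
  have h1 : (2⁻¹ : ℝ≥0∞) ^ (N + 1) * rhoN (N + 1) X Y < (2⁻¹ : ℝ≥0∞) ^ (N + 1) * δ := by
    refine (ENNReal.le_tsum (f := fun n : ℕ => (2⁻¹ : ℝ≥0∞) ^ (n + 1) * rhoN (n + 1) X Y)
      N).trans_lt (h.trans_eq ?_)
    push_cast
    rfl
  exact lt_of_mul_lt_mul_left' h1

theorem rho_self (X : Type u) [PseudoEMetricSpace X] : rho X X = 0 := by
  simp [rho, rhoN, Metric.hausdorffEDist_self]

theorem rho_comm (X : Type u) (Y : Type v) [PseudoEMetricSpace X] [PseudoEMetricSpace Y] :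
    rho X Y = rho Y X := by
  simp only [rho, rhoN, Metric.hausdorffEDist_comm]

theorem rho_triangle (X : Type u) (Y : Type v) (Z : Type w) [PseudoEMetricSpace X]
    [PseudoEMetricSpace Y] [PseudoEMetricSpace Z] : rho X Z ≤ rho X Y + rho Y Z := by
  rw [rho, rho, rho, ← ENNReal.tsum_add]
  refine ENNReal.tsum_le_tsum fun n => ?_
  rw [← mul_add]
  gcongr
  exact Metric.hausdorffEDist_triangle

theorem pyramidOf_eq {X : Type u} {Y : Type v} [PseudoEMetricSpace X] [PseudoEMetricSpace Y]
    (h : Precsim X Y) (h' : Precsim Y X) : pyramidOf X = pyramidOf Y :=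
  Set.ext fun _ => ⟨fun hp => precsim_trans hp h, fun hp => precsim_trans hp h'⟩

theorem rho_congr {X : Type u} {Y : Type v} {X' : Type*} {Y' : Type*} [PseudoEMetricSpace X]
    [PseudoEMetricSpace Y] [PseudoEMetricSpace X'] [PseudoEMetricSpace Y']
    (hX : Precsim X X') (hX' : Precsim X' X) (hY : Precsim Y Y') (hY' : Precsim Y' Y) :
    rho X Y = rho X' Y' := by
  simp only [rho, rhoN, pyramidOf_eq hX hX', pyramidOf_eq hY hY']

theorem precsim_of_rho_eq_zero {X : Type u} {Y : Type v} [PseudoEMetricSpace X]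
    [PseudoEMetricSpace Y] (h : rho X Y = 0) : Precsim X Y := by
  rw [precsim_iff_approx]
  intro n x M δ hδ
  have hδ3 : 0 < δ / 3 := by positivity
  obtain ⟨η, hη, hlt⟩ := exists_rhoN_lt_of_rho_lt.{u, v} (max n ⌈M⌉₊) hδ3
  obtain ⟨y, hy⟩ := exists_approx_of_rhoN_lt (M := M)
    ((le_max_left n ⌈M⌉₊).trans (Nat.le_succ _))
    ((Nat.le_ceil M).trans (by exact_mod_cast (le_max_right n ⌈M⌉₊).trans (Nat.le_succ _)))
    (hlt X Y (by rw [h]; exact_mod_cast hη)) x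
  refine ⟨y, fun i j => ?_⟩
  rw [mul_div_cancel₀ _ three_ne_zero] at hy
  exact hy i j

/-! ### Ultralimits -/

theorem min_lt_add_of_pos (a : ℝ≥0∞) (M : ℝ≥0) {δ : ℝ≥0} (hδ : 0 < δ) :
    min a M < a + δ := by
  rcases eq_or_ne a ⊤ with rfl | ha
  · simp
  · exact (min_le_left _ _).trans_lt (ENNReal.lt_add_right ha (by simpa using hδ.ne'))

section UltraLimit

variable (ω : Ultrafilter ℕ) (X : ℕ → Type u) [∀ n, EMetricSpace (X n)]

/-- Finitely many detecting sequences suffice, and evaluation at `n` nearly preserves their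
truncated distances for `ω`-most `n`. -/
theorem eventually_exists_mem_pyramidOf (N : ℕ) {ε : ℝ≥0} (hε : 0 < ε) :
    ∀ᶠ n in (ω : Filter ℕ), ∀ p ∈ pyramidOf (UltraSeq ω X) ∩ finiteSpaces N N,
      ∃ q ∈ pyramidOf (X n) ∩ finiteSpaces N N, edist p q ≤ (3 * ε : ℝ≥0) := by
  obtain ⟨S, hS, h⟩ := exists_finite_detecting.{u, u} (UltraSeq ω X) N hε
  have h1 : ∀ᶠ n in (ω : Filter ℕ), ∀ s ∈ S, ∀ t ∈ S,
      min (edist s t) N ≤ edist (s n) (t n) + ε := by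
    simp_rw [eventually_all_finite hS]
    intro s _ t _
    refine (((UltraSeq.tendsto_edist s t).add_const (ε : ℝ≥0∞)).eventually_const_lt ?_).mono
      fun n hn => le_of_lt hn
    exact_mod_cast min_lt_add_of_pos (edist s t) N hε
  exact h1.mono fun n hn => h (X n) (fun s => s n) hn

/-- If `ω`-most `X n` dominate a space near `c`, the maps `c → X n` assemble into a map from `c` to
sequences, with loss `3ε` in the limit. Passing from `p` to `c` adds `2ε`. -/
theorem exists_mem_pyramidOf_ultraSeq [∀ n, Nonempty (X n)] {N : ℕ} {ε : ℝ≥0} (hε : 0 < ε)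
    {c p : GHSpace} (hp : p ∈ finiteSpaces N N) (hpc : edist p c < ε)
    (h : ∀ᶠ n in (ω : Filter ℕ), ∃ q ∈ pyramidOf (X n) ∩ finiteSpaces N N, edist q c < ε) :
    ∃ q ∈ pyramidOf (UltraSeq ω X) ∩ finiteSpaces N N, edist p q ≤ (5 * ε : ℝ≥0) := by
  have hlt : ∀ {p q : GHSpace}, edist p q < ε → dist p q < ε := fun {p q} h => by
    rw [edist_nndist, ENNReal.coe_lt_coe, ← NNReal.coe_lt_coe, coe_nndist] at h
    exact h
  have h1 : ∀ n, ∃ y : c.Rep → X n,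
      (∃ q ∈ pyramidOf (X n) ∩ finiteSpaces N N, edist q c < ε) →
        ∀ a b, edist a b ≤ edist (y a) (y b) + (3 * ε : ℝ≥0) := by
    intro n
    by_cases hn : ∃ q ∈ pyramidOf (X n) ∩ finiteSpaces N N, edist q c < ε
    · obtain ⟨q, hq, hqc⟩ := hn
      rw [edist_comm] at hqc
      obtain ⟨φ, hφ⟩ := exists_expansion_of_dist_lt (hlt hqc)
      obtain ⟨y, hy⟩ := exists_approx_rep hq hε
      refine ⟨y ∘ φ, fun _ a b => (hφ a b).trans ((add_le_add_left (hy _ _) _).trans_eq ?_)⟩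
      rw [add_assoc, ← ENNReal.coe_add, Function.comp, Function.comp]
      congr 2
      ring
    -- The remaining indices form an `ω`-null set, so any values serve there.
    · exact ⟨fun _ => Classical.arbitrary _, fun h => absurd h hn⟩
  choose y hy using h1
  let x : c.Rep → UltraSeq ω X := fun a n => y n a
  have hx : ∀ a b, edist a b ≤ edist (x a) (x b) + (3 * ε : ℝ≥0) := fun a b =>
    ge_of_tendsto ((UltraSeq.tendsto_edist (x a) (x b)).add_const _)
      (h.mono fun n hn => hy n hn a b)
  obtain ⟨φ, hφ⟩ := exists_expansion_of_dist_lt (hlt hpc)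
  refine exists_mem_pyramidOf_dist_le hp (fun a => x (φ a)) fun a b =>
    (hφ a b).trans ((add_le_add_left (hx _ _) _).trans_eq ?_)
  rw [add_assoc, ← ENNReal.coe_add]
  congr 2
  ring

theorem eventually_exists_mem_pyramidOf_ultraSeq [∀ n, Nonempty (X n)] (N : ℕ) {ε : ℝ≥0}
    (hε : 0 < ε) : ∀ᶠ n in (ω : Filter ℕ), ∀ p ∈ pyramidOf (X n) ∩ finiteSpaces N N,
      ∃ q ∈ pyramidOf (UltraSeq ω X) ∩ finiteSpaces N N, edist p q ≤ (5 * ε : ℝ≥0) := by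
  obtain ⟨t, -, htf, ht⟩ := exists_finite_net (subset_refl (finiteSpaces N N)) hε
  -- Ultrafilter dichotomy: each net centre `c` is approached either for `ω`-most `n` or for
  -- `ω`-almost none. Finiteness of `t` lets the centres of the second kind be discarded
  -- simultaneously.
  have h1 : ∀ᶠ n in (ω : Filter ℕ), ∀ c ∈ t,
      (∃ q ∈ pyramidOf (X n) ∩ finiteSpaces N N, edist q c < ε) →
      ∀ᶠ n in (ω : Filter ℕ), ∃ q ∈ pyramidOf (X n) ∩ finiteSpaces N N, edist q c < ε := by
    rw [eventually_all_finite htf]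
    intro c _
    by_cases h : ∀ᶠ n in (ω : Filter ℕ),
      ∃ q ∈ pyramidOf (X n) ∩ finiteSpaces N N, edist q c < ε
    · exact Eventually.of_forall fun _ _ => h
    · exact (Ultrafilter.eventually_not.2 h).mono fun n hn h => absurd h hn
  filter_upwards [h1] with n hn p hp
  obtain ⟨c, hc, hpc⟩ := ht p hp.2
  exact exists_mem_pyramidOf_ultraSeq ω X hε hp.2 hpc (hn c hc ⟨p, hp, hpc⟩)

theorem tendsto_rho_ultraSeq [∀ n, Nonempty (X n)] :
    Tendsto (fun n => rho (X n) (UltraSeq ω X)) ω (𝓝 0) := by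
  rw [ENNReal.tendsto_nhds_zero]
  intro η hη
  obtain ⟨ε, hε, hεη⟩ := ENNReal.lt_iff_exists_nnreal_btwn.1 hη
  rw [ENNReal.coe_pos] at hε
  have h10 : 0 < ε / 10 := by positivity
  obtain ⟨N₀, hN₀⟩ := exists_rho_le_of_rhoN_le.{u, u} (ε := ε / 2) (by positivity)
  have h1 : ∀ᶠ n in (ω : Filter ℕ), ∀ N ∈ Set.Iic N₀,
      rhoN N (X n) (UltraSeq ω X) ≤ (ε / 2 : ℝ≥0) := by
    rw [eventually_all_finite (Set.finite_Iic N₀)]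
    intro N _
    filter_upwards [eventually_exists_mem_pyramidOf ω X N h10,
      eventually_exists_mem_pyramidOf_ultraSeq ω X N h10] with n hn hn'
    refine Metric.hausdorffEDist_le_of_mem_edist (fun p hp => ?_) fun p hp => ?_
    · obtain ⟨q, hq, h⟩ := hn' p hp
      refine ⟨q, hq, h.trans_eq ?_⟩
      congr 1
      ring
    · obtain ⟨q, hq, h⟩ := hn p hp
      refine ⟨q, hq, h.trans (ENNReal.coe_le_coe.2 ?_)⟩
      calc 3 * (ε / 10) ≤ 5 * (ε / 10) := by gcongr; norm_num
        _ = ε / 2 := by ring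
  filter_upwards [h1] with n hn
  refine ((hN₀ _ _ fun N hN => hn N hN).trans ?_).trans hεη.le
  rw [mul_div_cancel₀ _ two_ne_zero]

theorem precsim_ultraSeq_ultraLimit : Precsim (UltraSeq ω X) (UltraLimit ω X) :=
  precsim_of_isometry (f := SeparationQuotient.mk) fun _ _ => rfl

theorem precsim_ultraLimit_ultraSeq : Precsim (UltraLimit ω X) (UltraSeq ω X) :=
  precsim_of_isometry (f := Quotient.out) fun a b => by
    conv_rhs => rw [← Quotient.out_eq a, ← Quotient.out_eq b]
    rfl

end UltraLimit

/-! ### Approximation by compact spaces -/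

theorem exists_rho_rep_le (X : Type u) [PseudoEMetricSpace X] [Nonempty X] {ε : ℝ≥0}
    (hε : 0 < ε) : ∃ p : GHSpace, rho p.Rep X ≤ ε := by
  obtain ⟨N₀, hN₀⟩ := exists_rho_le_of_rhoN_le.{0, u} (ε := ε / 2) (by positivity)
  have h6 : 0 < ε / 6 := by positivity
  choose S hS hdet using fun N => exists_finite_detecting.{u, 0} X N h6
  obtain ⟨x₀⟩ := ‹Nonempty X›
  have hT : (insert x₀ (⋃ N ∈ Set.Iic N₀, S N)).Finite :=
    ((Set.finite_Iic N₀).biUnion fun N _ => hS N).insert x₀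
  obtain ⟨n, x, hx⟩ := hT.fin_embedding
  have hn : NeZero n := ⟨by
    rintro rfl
    have : x₀ ∈ Set.range x := hx ▸ Set.mem_insert _ _
    obtain ⟨i, -⟩ := this
    exact i.elim0⟩
  obtain ⟨p, hp, g, -, hg⟩ := exists_rangeSpace_truncation x N₀ (le_max_left n N₀)
    (by exact_mod_cast le_max_right n N₀)
  refine ⟨p, (hN₀ p.Rep X fun N hN => ?_).trans_eq (by rw [mul_div_cancel₀ _ two_ne_zero])⟩
  refine Metric.hausdorffEDist_le_of_mem_edist (fun q hq => ?_) fun q hq => ?_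
  -- Since `p ≾ X`, this inclusion is exact; only the other one needs the detecting points.
  · exact ⟨q, ⟨precsim_trans hq.1 hp.1, hq.2⟩, by simp⟩
  · have hidx : ∀ s : X, ∃ i, s ∈ S N → x i = s := fun s => by
      by_cases hs : s ∈ S N
      · have : s ∈ Set.range x := hx ▸ Set.mem_insert_of_mem _ (Set.mem_biUnion hN hs)
        obtain ⟨i, hi⟩ := this
        exact ⟨i, fun _ => hi⟩
      -- Points outside `S N` play no role, so index `0` is a default; adjoining `x₀` ensured that
      -- it exists.
      · exact ⟨0, fun h => absurd h hs⟩
    choose idx hidx using hidx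
    obtain ⟨r, hr, h⟩ := hdet N p.Rep (fun s => g (idx s)) (fun s hs t ht => by
      rw [hg, hidx s hs, hidx t ht]
      refine le_trans ?_ le_self_add
      gcongr
      exact_mod_cast hN) q hq
    refine ⟨r, hr, h.trans_eq ?_⟩
    congr 1
    ring

/-! ### Compact spaces -/

theorem rho_rep_le (p q : GHSpace) : rho p.Rep q.Rep ≤ 3 * edist p q := by
  have key : ∀ {p q : GHSpace} {δ : ℝ≥0} {N : ℕ}, edist p q < δ →
      ∀ r ∈ pyramidOf p.Rep ∩ finiteSpaces N N, ∃ s ∈ pyramidOf q.Rep ∩ finiteSpaces N N,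
        edist r s ≤ (3 * δ : ℝ≥0) := by
    intro p q δ N h r hr
    have hδ : 0 < δ := by exact_mod_cast (zero_le (a := edist p q)).trans_lt h
    rw [edist_nndist, ENNReal.coe_lt_coe, ← NNReal.coe_lt_coe, coe_nndist] at h
    obtain ⟨φ, hφ⟩ := exists_expansion_of_dist_lt h
    obtain ⟨y, hy⟩ := exists_approx_rep hr hδ
    refine exists_mem_pyramidOf_dist_le hr.2 (fun a => φ (y a)) fun a b =>
      (hy a b).trans ((add_le_add_left (hφ _ _) _).trans_eq ?_)
    rw [add_assoc, ← ENNReal.coe_add]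
    congr 2
    ring
  refine rho_le_of_rhoN_le fun N => ?_
  have h1 : ∀ δ : ℝ≥0, edist p q < δ → rhoN N p.Rep q.Rep ≤ 3 * δ := fun δ hδ =>
    Metric.hausdorffEDist_le_of_mem_edist (fun r hr => by simpa using key hδ r hr)
      fun r hr => by simpa using key (edist_comm p q ▸ hδ) r hr
  have h2 : Tendsto (fun δ : ℝ≥0 => 3 * (δ : ℝ≥0∞)) (𝓝[>] (nndist p q)) (𝓝 (3 * edist p q)) := by
    have : Continuous fun δ : ℝ≥0 => 3 * (δ : ℝ≥0∞) := by fun_prop (disch := simp)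
    rw [edist_nndist]
    exact (this.tendsto _).mono_left nhdsWithin_le_nhds
  refine ge_of_tendsto h2 (eventually_mem_nhdsWithin.mono fun δ hδ => h1 δ ?_)
  rw [edist_nndist]
  exact_mod_cast hδ

/-! ### Mutually dominating compact spaces are isometric. -/

theorem Precsim.exists_expanding {X : Type u} {Y : Type v} [PseudoMetricSpace X]
    [PseudoMetricSpace Y] [CompactSpace Y] (h : Precsim X Y) :
    ∃ f : X → Y, ∀ a b, edist a b ≤ edist (f a) (f b) := by
  classical
  rcases isEmpty_or_nonempty X with hX | ⟨⟨x₀⟩⟩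
  · exact ⟨isEmptyElim, isEmptyElim⟩
  obtain ⟨y₀, -⟩ := h.exists_approx (fun _ : Unit => x₀) 0 one_pos
  have h1 : ∀ Sk : Finset X × ℕ, ∃ y : X → Y, ∀ a ∈ Sk.1, ∀ b ∈ Sk.1,
      min (edist a b) Sk.2 ≤ edist (y a) (y b) + ((1 / ((Sk.2 : ℝ≥0) + 1) : ℝ≥0) : ℝ≥0∞) := by
    rintro ⟨S, k⟩
    obtain ⟨y, hy⟩ := h.exists_approx (fun s : S => (s : X)) k
      (δ := 1 / ((k : ℝ≥0) + 1)) (by positivity)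
    refine ⟨fun a => if ha : a ∈ S then y ⟨a, ha⟩ else y₀ (), fun a ha b hb => ?_⟩
    simpa [ha, hb] using hy ⟨a, ha⟩ ⟨b, hb⟩
  choose y hy using h1
  let U : Ultrafilter (Finset X × ℕ) := Ultrafilter.of atTop
  -- `X → Y` is compact by Tychonoff, so the approximate maps on finite sets have a pointwise limit
  -- along `U`, where both the error and the truncation disappear.
  obtain ⟨f, -, hf⟩ := isCompact_univ.ultrafilter_le_nhds (U.map y) (by simp)
  refine ⟨f, fun a b => ENNReal.le_of_forall_pos_le_add fun ε hε _ => ?_⟩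
  have hlim : Tendsto y U (𝓝 f) := hf
  rw [tendsto_pi_nhds] at hlim
  refine ge_of_tendsto (((hlim a).edist (hlim b)).add_const (ε : ℝ≥0∞)) ?_
  obtain ⟨k₁, hk₁⟩ := exists_nat_ge (nndist a b)
  obtain ⟨k₂, hk₂⟩ := exists_nat_one_div_lt (K := ℝ≥0) hε
  refine Ultrafilter.of_le (atTop : Filter (Finset X × ℕ))
    ((eventually_ge_atTop (({a, b} : Finset X), max k₁ k₂)).mono ?_)
  rintro ⟨S, k⟩ ⟨hS, hk⟩
  have h2 := hy (S, k) a (hS (by simp)) b (hS (by simp))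
  have h3 : edist a b ≤ k := by
    rw [edist_nndist]
    exact_mod_cast hk₁.trans (by exact_mod_cast (le_max_left _ _).trans hk)
  rw [min_eq_left h3] at h2
  refine h2.trans (add_le_add_right (ENNReal.coe_le_coe.2 (le_trans ?_ hk₂.le)) _)
  have : (k₂ : ℝ≥0) ≤ k := by exact_mod_cast (le_max_right _ _).trans hk
  gcongr

section Expanding

variable {X : Type u} [PseudoMetricSpace X] [CompactSpace X] {h : X → X}

theorem dist_le_dist_iterate {X : Type u} [PseudoMetricSpace X] {h : X → X}
    (hh : ∀ a b, dist a b ≤ dist (h a) (h b)) (n : ℕ) (a b : X) :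
    dist a b ≤ dist (h^[n] a) (h^[n] b) := by
  induction n with
  | zero => simp
  | succ n ih =>
    rw [Function.iterate_succ_apply', Function.iterate_succ_apply']
    exact ih.trans (hh _ _)

/-- Two late iterates of a convergent subsequence are close, and expansion lets the common number of
iterations be cancelled. -/
theorem exists_dist_iterate_lt (hh : ∀ a b, dist a b ≤ dist (h a) (h b)) (x : X) {ε : ℝ}
    (hε : 0 < ε) : ∃ k : ℕ, dist x (h^[k + 1] x) < ε := by
  obtain ⟨z, φ, hφ, hz⟩ := CompactSpace.tendsto_subseq fun n => h^[n] x
  obtain ⟨n, hn⟩ := Metric.cauchySeq_iff'.1 hz.cauchySeq ε hε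
  have h1 := hn (n + 1) n.le_succ
  have h2 : φ n < φ (n + 1) := hφ n.lt_succ_self
  obtain ⟨k, hk⟩ := Nat.exists_eq_add_of_lt h2
  refine ⟨k, (dist_le_dist_iterate hh (φ n) _ _).trans_lt ?_⟩
  rw [← Function.iterate_add_apply, show φ n + (k + 1) = φ (n + 1) by omega, dist_comm]
  exact h1

theorem isometry_of_expanding (hh : ∀ a b, dist a b ≤ dist (h a) (h b)) : Isometry h := by
  refine Isometry.of_dist_eq fun a b => le_antisymm ?_ (hh a b)
  refine le_of_forall_pos_le_add fun ε hε => ?_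
  have hh2 : ∀ z w : X × X, dist z w ≤ dist (Prod.map h h z) (Prod.map h h w) := fun z w =>
    max_le_max (hh _ _) (hh _ _)
  -- Recurrence on `X × X` makes `a` and `b` return at the same time; `dist (h a) (h b)` is at most
  -- the distance of the returned points.
  obtain ⟨k, hk⟩ := exists_dist_iterate_lt hh2 (a, b) (half_pos hε)
  rw [Prod.map_iterate, Prod.map_apply, Prod.dist_eq, max_lt_iff] at hk
  have h1 := dist_le_dist_iterate hh k (h a) (h b)
  rw [← Function.iterate_succ_apply, ← Function.iterate_succ_apply] at h1
  have h2 := dist_triangle4 (h^[k + 1] a) a b (h^[k + 1] b)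
  rw [dist_comm (h^[k + 1] a) a] at h2
  have h3 := hk.1
  have h4 := hk.2
  dsimp only at h3 h4
  linarith

end Expanding

theorem surjective_of_expanding {X : Type u} [MetricSpace X] [CompactSpace X] {h : X → X}
    (hh : ∀ a b, dist a b ≤ dist (h a) (h b)) : Function.Surjective h := by
  intro x
  have hcl : IsClosed (Set.range h) :=
    (isCompact_range (isometry_of_expanding hh).continuous).isClosed
  change x ∈ Set.range h
  rw [← hcl.closure_eq, Metric.mem_closure_iff]
  intro ε hε
  obtain ⟨k, hk⟩ := exists_dist_iterate_lt hh x hε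
  exact ⟨_, ⟨h^[k] x, rfl⟩, by rwa [← Function.iterate_succ_apply' h]⟩

theorem nonempty_isometryEquiv_of_precsim {X : Type u} {Y : Type v} [MetricSpace X]
    [CompactSpace X] [MetricSpace Y] [CompactSpace Y] (h : Precsim X Y) (h' : Precsim Y X) :
    Nonempty (X ≃ᵢ Y) := by
  obtain ⟨f, hf⟩ := h.exists_expanding
  obtain ⟨g, hg⟩ := h'.exists_expanding
  have hgf := isometry_of_expanding (h := g ∘ f) fun a b => by
    rw [dist_edist, dist_edist]
    exact ENNReal.toReal_mono (edist_ne_top _ _) ((hf a b).trans (hg _ _))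
  have hfg := surjective_of_expanding (h := f ∘ g) fun a b => by
    rw [dist_edist, dist_edist]
    exact ENNReal.toReal_mono (edist_ne_top _ _) ((hg a b).trans (hf _ _))
  have hfi : Isometry f := fun a b =>
    le_antisymm ((hg _ _).trans_eq (hgf a b)) (hf a b)
  exact ⟨⟨Equiv.ofBijective f ⟨hfi.injective, hfg.of_comp⟩, hfi⟩⟩

/-! ### Spaces close to a compact space -/

/-- An `ε`-separated family of largest possible size is an `ε`-net: an uncovered point could be
added to it. -/
theorem exists_net_of_not_separated {Z : Type u} [PseudoMetricSpace Z] {ε : ℝ} {K : ℕ}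
    (hK : ∀ z : Fin K → Z, ∃ i j, i ≠ j ∧ dist (z i) (z j) < ε) :
    ∃ n ≤ K, ∃ z : Fin n → Z, ∀ a, ∃ i, dist a (z i) < ε := by
  classical
  have hex : ∃ n : ℕ, ∀ z : Fin n → Z, ∃ i j, i ≠ j ∧ dist (z i) (z j) < ε := ⟨K, hK⟩
  obtain ⟨n, hn⟩ : ∃ n, Nat.find hex = n + 1 := by
    refine Nat.exists_eq_succ_of_ne_zero fun h0 => ?_
    have := Nat.find_spec hex
    rw [h0] at this
    obtain ⟨i, -⟩ := this fun i => i.elim0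
    exact i.elim0
  have hspec := Nat.find_spec hex
  rw [hn] at hspec
  have hmin := Nat.find_min hex (m := n) (by omega)
  push Not at hmin
  obtain ⟨z, hz⟩ := hmin
  refine ⟨n, ?_, z, fun a => ?_⟩
  · have := Nat.find_min' hex hK
    omega
  · by_contra! hcon
    obtain ⟨i, j, hij, hd⟩ := hspec (Fin.cons a z)
    refine hd.not_ge ?_
    induction i using Fin.cases with
    | zero =>
      induction j using Fin.cases with
      | zero => exact absurd rfl hij
      | succ j => simpa using hcon j
    | succ i =>
      induction j using Fin.cases with
      | zero => simpa [dist_comm] using hcon i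
      | succ j => simpa using hz i j (fun h => hij (by rw [h]))

theorem exists_not_separated (X : Type u) [PseudoMetricSpace X] [CompactSpace X] {ε : ℝ}
    (hε : 0 < ε) : ∃ K : ℕ, ∀ z : Fin K → X, ∃ i j, i ≠ j ∧ dist (z i) (z j) < ε := by
  obtain ⟨t, -, htf, ht⟩ := finite_cover_balls_of_compact (isCompact_univ (X := X))
    (half_pos hε)
  have := htf.fintype
  refine ⟨Fintype.card t + 1, fun z => ?_⟩
  have h1 : ∀ i, ∃ c : t, dist (z i) c < ε / 2 := fun i => by
    obtain ⟨c, hc, h⟩ := Set.mem_iUnion₂.1 (ht (Set.mem_univ (z i)))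
    exact ⟨⟨c, hc⟩, h⟩
  choose c hc using h1
  obtain ⟨i, j, hij, h⟩ := Fintype.exists_ne_map_eq_of_card_lt c (by simp)
  refine ⟨i, j, hij, (dist_triangle_right _ _ (c i : X)).trans_lt ?_⟩
  have h2 := hc i
  have h3 := hc j
  rw [← h] at h3
  linarith

/-- The compact spaces that are sufficiently `ρ`-close to a given compact space are covered by
finitely many small balls of the Gromov–Hausdorff space. -/
theorem exists_finite_cover_of_rho_lt (p : GHSpace) {ε : ℝ≥0} (hε : 0 < ε) :
    ∃ η : ℝ≥0, 0 < η ∧ ∃ t : Set GHSpace, t.Finite ∧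
      ∀ q : GHSpace, rho q.Rep p.Rep < η → ∃ c ∈ t, edist q c < (2 * ε : ℝ≥0) := by
  obtain ⟨K, hK⟩ := exists_not_separated p.Rep (ε := ε / 2) (by positivity)
  let D : ℝ≥0 := ⟨Metric.diam (Set.univ : Set p.Rep), Metric.diam_nonneg⟩
  have hD : ∀ a b : p.Rep, edist a b ≤ D := fun a b => by
    rw [edist_nndist, ENNReal.coe_le_coe, ← NNReal.coe_le_coe, coe_nndist]
    exact Metric.dist_le_diam_of_mem isCompact_univ.isBounded (Set.mem_univ a) (Set.mem_univ b)
  -- Level `N + 1` must accommodate pairs (to bound diameters), `K`-point families (to bound nets)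
  -- and truncation at `D + ε`.
  let N : ℕ := max (max K 2) ⌈D + ε⌉₊
  have hNK : K ≤ N + 1 := ((le_max_left _ _).trans (le_max_left _ _)).trans N.le_succ
  have hN2 : 2 ≤ N + 1 := ((le_max_right _ _).trans (le_max_left _ _)).trans N.le_succ
  have hND : D + ε ≤ (N + 1 : ℕ) :=
    (Nat.le_ceil _).trans (by exact_mod_cast (le_max_right _ _).trans N.le_succ)
  obtain ⟨η, hη, hlt⟩ := exists_rhoN_lt_of_rho_lt.{0, 0} N (δ := ε / 6) (by positivity)
  obtain ⟨t, -, htf, ht⟩ := exists_finite_net (subset_refl (finiteSpaces (N + 1) (N + 1 : ℕ))) hε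
  have h36 : 3 * (ε / 6) = ε / 2 := by ring
  refine ⟨η, hη, t, htf, fun q hq => ?_⟩
  -- With loss `ε / 2`, a distance truncated at `D + ε` is at most `D + ε / 2`, so the truncation
  -- was not active.
  have hdiam : ∀ a b : q.Rep, dist a b ≤ D + ε := fun a b => by
    obtain ⟨y, hy⟩ := exists_approx_of_rhoN_lt hN2 hND (hlt _ _ hq) ![a, b]
    have h1 := (hy 0 1).trans (add_le_add_left (hD _ _) _)
    rw [h36, ← ENNReal.coe_add] at h1
    have h2 : ¬ D + ε ≤ D + ε / 2 := by
      rw [add_le_add_iff_left, not_le]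
      exact NNReal.half_lt_self hε.ne'
    rcases min_le_iff.1 h1 with h3 | h3
    · have h4 : edist a b ≤ (D + ε / 2 : ℝ≥0) := h3
      rw [edist_nndist, ENNReal.coe_le_coe] at h4
      have h5 := h4.trans (add_le_add_right (NNReal.half_le_self ε) D)
      exact_mod_cast h5
    · exact absurd (ENNReal.coe_le_coe.1 h3) h2
  -- An `ε`-separated `K`-tuple of `q` would map to an `ε / 2`-separated one of `p`, against the
  -- choice of `K`.
  have hsep : ∀ z : Fin K → q.Rep, ∃ i j, i ≠ j ∧ dist (z i) (z j) < ε := fun z => by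
    by_contra! hcon
    obtain ⟨y, hy⟩ := exists_approx_of_rhoN_lt (M := ε) hNK (le_add_self.trans hND)
      (hlt _ _ hq) z
    obtain ⟨i, j, hij, h1⟩ := hK y
    have h2 : (ε : ℝ≥0∞) ≤ edist (z i) (z j) := by
      rw [edist_nndist, ENNReal.coe_le_coe]
      exact_mod_cast hcon i j hij
    have h3 := hy i j
    rw [min_eq_right h2, h36, edist_nndist, ← ENNReal.coe_add, ENNReal.coe_le_coe,
      ← NNReal.coe_le_coe] at h3
    push_cast at h3
    linarith
  obtain ⟨n, hn, z, hz⟩ := exists_net_of_not_separated hsep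
  obtain ⟨i₀, -⟩ := hz (Classical.arbitrary q.Rep)
  have : Nonempty (Fin n) := ⟨i₀⟩
  obtain ⟨c, hc, hzc⟩ := ht (rangeSpace z) (rangeSpace_mem_finiteSpaces (Nat.cast_nonneg _)
    (by simpa using hn.trans hNK) fun i j => (hdiam _ _).trans (by exact_mod_cast hND))
  refine ⟨c, hc, (edist_triangle q (rangeSpace z) c).trans_lt ?_⟩
  rw [two_mul, ENNReal.coe_add]
  refine ENNReal.add_lt_add_of_le_of_lt (edist_ne_top _ _) ?_ hzc
  rw [edist_nndist, ENNReal.coe_le_coe, ← NNReal.coe_le_coe, coe_nndist]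
  exact dist_rangeSpace_le isometry_id ε.coe_nonneg
    (fun a => (hz a).imp fun _ h => h.le) fun i => ⟨z i, by simp⟩

/-! ### The metric space `𝓜/∼` -/

theorem MQuot.exists_rep (a : MQuot.{u}) : ∃ X : ExtMetricSpace.{u}, MQuot.mk X.carrier = a := by
  induction a using Quotient.inductionOn with
  | h b =>
    induction b using Quotient.inductionOn with
    | h X => exact ⟨X, rfl⟩

/-- An extended metric space in a given class. -/
noncomputable def MQuot.rep (a : MQuot.{u}) : ExtMetricSpace.{u} := a.exists_rep.choose

theorem MQuot.mk_rep (a : MQuot.{u}) : MQuot.mk a.rep.carrier = a := a.exists_rep.choose_spec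

theorem MQuot.rho_rep_mk (X Y : Type u) [EMetricSpace X] [Nonempty X] [EMetricSpace Y]
    [Nonempty Y] : rho (MQuot.mk X).rep.carrier (MQuot.mk Y).rep.carrier = rho X Y := by
  obtain ⟨h1, h2⟩ := (MQuot.mk_eq_mk_iff _ _).1 (MQuot.mk_rep (MQuot.mk X))
  obtain ⟨h3, h4⟩ := (MQuot.mk_eq_mk_iff _ _).1 (MQuot.mk_rep (MQuot.mk Y))
  exact rho_congr h1 h2 h3 h4

/-- The extended metric on `𝓜/∼` induced by `ρ`. -/
@[reducible]
noncomputable def MQuot.emetricSpace : EMetricSpace MQuot.{u} where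
  edist a b := rho a.rep.carrier b.rep.carrier
  edist_self _ := rho_self _
  edist_comm _ _ := rho_comm _ _
  edist_triangle _ _ _ := rho_triangle _ _ _
  eq_of_edist_eq_zero {a b} h := by
    rw [← a.mk_rep, ← b.mk_rep, MQuot.mk_eq_mk_iff]
    exact ⟨precsim_of_rho_eq_zero h, precsim_of_rho_eq_zero ((rho_comm _ _).trans h)⟩

/-- The metric on `𝓜/∼` induced by `ρ`. -/
noncomputable instance : MetricSpace MQuot.{u} :=
  letI := MQuot.emetricSpace.{u}
  EMetricSpace.toMetricSpace fun _ _ => rho_ne_top _ _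

theorem MQuot.edist_eq (a b : MQuot.{u}) : edist a b = rho a.rep.carrier b.rep.carrier := rfl

theorem MQuot.edist_mk_mk (X Y : Type u) [EMetricSpace X] [Nonempty X] [EMetricSpace Y]
    [Nonempty Y] : edist (MQuot.mk X) (MQuot.mk Y) = rho X Y :=
  MQuot.rho_rep_mk X Y

theorem precsim_ulift (X : Type v) [EMetricSpace X] : Precsim (ULift.{u} X) X :=
  precsim_of_isometry (f := ULift.down) fun _ _ => rfl

theorem precsim_ulift' (X : Type v) [EMetricSpace X] : Precsim X (ULift.{u} X) :=
  precsim_of_isometry (f := ULift.up) fun _ _ => rfl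

theorem edist_proj_proj (p q : GHSpace) : edist (proj.{u} p) (proj.{u} q) = rho p.Rep q.Rep :=
  (MQuot.edist_mk_mk _ _).trans (rho_congr (precsim_ulift _) (precsim_ulift' _)
    (precsim_ulift _) (precsim_ulift' _))

/-- No convergence of `X n` is assumed, which is what makes this a source of compactness. -/
theorem tendsto_mk_ultraLimit (ω : Ultrafilter ℕ) (X : ℕ → Type u) [∀ n, EMetricSpace (X n)]
    [∀ n, Nonempty (X n)] :
    Tendsto (fun n => MQuot.mk (X n)) ω (𝓝 (MQuot.mk (UltraLimit ω X))) := by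
  rw [tendsto_iff_edist_tendsto_0]
  refine (tendsto_rho_ultraSeq ω X).congr fun n => ?_
  rw [MQuot.edist_mk_mk]
  exact rho_congr (precsim_refl _) (precsim_refl _) (precsim_ultraSeq_ultraLimit ω X)
    (precsim_ultraLimit_ultraSeq ω X)

instance : CompactSpace MQuot.{u} := by
  rw [compactSpace_iff_seqCompactSpace]
  refine ⟨fun a _ => ?_⟩
  let X : ℕ → Type u := fun n => (a n).rep.carrier
  have h : Tendsto a (hyperfilter ℕ : Filter ℕ) (𝓝 (MQuot.mk (UltraLimit (hyperfilter ℕ) X))) := by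
    have h1 := tendsto_mk_ultraLimit (hyperfilter ℕ) X
    simpa only [X, MQuot.mk_rep] using h1
  refine ⟨_, Set.mem_univ _, MapClusterPt.tendsto_subseq
    (h.mapClusterPt.mono ?_)⟩
  rw [← Nat.cofinite_eq_atTop]
  exact hyperfilter_le_cofinite

/-! ### The projection: Lipschitz bound, embedding, density. -/

theorem lipschitzWith_proj : LipschitzWith 3 proj.{u} := fun p q => by
  rw [edist_proj_proj]
  exact_mod_cast rho_rep_le p q

theorem injective_proj : Function.Injective proj.{u} := fun p q h => by
  obtain ⟨h1, h2⟩ := (MQuot.mk_eq_mk_iff _ _).1 h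
  rw [← p.toGHSpace_rep, ← q.toGHSpace_rep, toGHSpace_eq_toGHSpace_iff_isometryEquiv]
  exact nonempty_isometryEquiv_of_precsim
    (precsim_trans (precsim_ulift' _) (precsim_trans h1 (precsim_ulift _)))
    (precsim_trans (precsim_ulift' _) (precsim_trans h2 (precsim_ulift _)))

theorem cauchy_of_le_comap_proj {p : GHSpace} {U : Ultrafilter GHSpace}
    (hU : ↑U ≤ comap proj.{u} (𝓝 (proj p))) : Cauchy (U : Filter GHSpace) := by
  refine EMetric.cauchy_iff.2 ⟨U.neBot.ne, fun ε hε => ?_⟩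
  obtain ⟨δ, hδ, hδε⟩ := ENNReal.lt_iff_exists_nnreal_btwn.1 hε
  rw [ENNReal.coe_pos] at hδ
  obtain ⟨η, hη, t, ht, hcov⟩ := exists_finite_cover_of_rho_lt p (ε := δ / 4) (by positivity)
  have h1 : {q : GHSpace | rho q.Rep p.Rep < η} ∈ U := by
    refine hU ⟨Metric.eball (proj p) η, Metric.eball_mem_nhds _ (by simpa using hη), ?_⟩
    intro q hq
    rw [Set.mem_preimage, Metric.mem_eball, edist_proj_proj] at hq
    exact hq
  have h2 : ⋃ c ∈ t, Metric.eball c (2 * (δ / 4) : ℝ≥0) ∈ U := by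
    refine mem_of_superset h1 fun q hq => ?_
    obtain ⟨c, hc, h⟩ := hcov q hq
    exact Set.mem_biUnion hc h
  -- An ultrafilter containing a finite union of balls of radius `δ / 2` contains one of them, whose
  -- points are less than `δ` apart.
  obtain ⟨c, -, hc⟩ := (Ultrafilter.finite_biUnion_mem_iff ht).1 h2
  refine ⟨_, hc, fun x hx y hy => ((edist_triangle_right x y c).trans_lt
    (ENNReal.add_lt_add hx hy)).trans_eq ?_ |>.trans hδε⟩
  rw [← ENNReal.coe_add]
  congr 1
  ring

theorem isEmbedding_proj : IsEmbedding proj.{u} := by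
  refine ⟨isInducing_iff_nhds.2 fun p => le_antisymm
    lipschitzWith_proj.continuous.continuousAt.tendsto.le_comap ?_, injective_proj⟩
  rw [le_iff_ultrafilter]
  intro U hU
  obtain ⟨q, hq⟩ := CompleteSpace.complete (cauchy_of_le_comap_proj hU)
  have h1 : Tendsto proj.{u} U (𝓝 (proj q)) :=
    (lipschitzWith_proj.continuous.tendsto q).mono_left hq
  have h2 : Tendsto proj.{u} U (𝓝 (proj p)) := tendsto_iff_comap.2 hU
  rwa [← injective_proj (tendsto_nhds_unique h1 h2)]

theorem denseRange_proj : DenseRange proj.{u} := fun a => by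
  refine EMetric.mem_closure_iff.2 fun ε hε => ?_
  obtain ⟨δ, hδ, hδε⟩ := ENNReal.lt_iff_exists_nnreal_btwn.1 hε
  obtain ⟨p, hp⟩ := exists_rho_rep_le a.rep.carrier (ENNReal.coe_pos.1 hδ)
  refine ⟨proj p, ⟨p, rfl⟩, lt_of_le_of_lt ?_ hδε⟩
  rw [← a.mk_rep, proj, MQuot.edist_mk_mk, rho_comm]
  exact (rho_congr (precsim_ulift _) (precsim_ulift' _) (precsim_refl _)
    (precsim_refl _)).trans_le hp

end GHCompactification

theorem theorem1 :
    ∃ _ : MetricSpace GHCompactification.MQuot.{u},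
      -- the metric is the one induced by `ρ`, and it is compact
      (∀ (X Y : Type u) [EMetricSpace X] [Nonempty X] [EMetricSpace Y] [Nonempty Y],
        edist (GHCompactification.MQuot.mk X) (GHCompactification.MQuot.mk Y) =
          GHCompactification.rho X Y) ∧
      CompactSpace GHCompactification.MQuot.{u} ∧
      -- the projection is a 3-Lipschitz topological embedding
      LipschitzWith 3 GHCompactification.proj.{u} ∧
      IsEmbedding GHCompactification.proj.{u} ∧
      -- with dense image
      DenseRange GHCompactification.proj.{u} ∧
      -- ultralimits of a convergent sequence are equivalent to its limit
      (∀ (X : ℕ → Type u) [∀ n, EMetricSpace (X n)] [∀ n, Nonempty (X n)]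
        (Y : Type u) [EMetricSpace Y] [Nonempty Y],
        Tendsto (fun n => GHCompactification.MQuot.mk (X n)) atTop
          (𝓝 (GHCompactification.MQuot.mk Y)) →
        ∀ ω : Ultrafilter ℕ, (ω : Filter ℕ) ≤ cofinite →
          GHCompactification.Precsim (GHCompactification.UltraLimit ω X) Y ∧
            GHCompactification.Precsim Y (GHCompactification.UltraLimit ω X)) := by
  refine ⟨inferInstance, fun X Y _ _ _ _ => GHCompactification.MQuot.edist_mk_mk X Y, inferInstance,
    GHCompactification.lipschitzWith_proj, GHCompactification.isEmbedding_proj,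
    GHCompactification.denseRange_proj, ?_⟩
  intro X _ _ Y _ _ h ω hω
  rw [Nat.cofinite_eq_atTop] at hω
  exact (GHCompactification.MQuot.mk_eq_mk_iff _ _).1
    (tendsto_nhds_unique (GHCompactification.tendsto_mk_ultraLimit ω X) (h.mono_left hω))
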